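/- Let $\mathcal{M}$ be a smooth (Hausdorff, finite-dimensional, boundaryless) manifold with a smooth Riemannian metric $\langle\cdot,\cdot\rangle$ and a retraction $\mathcal{R}$, i.e. a smooth map $\mathcal{R}:\mathcal{S}\to\mathcal{M}$ on an open set $\mathcal{S}\subset T\mathcal{M}$ containing $(x,0_x)$ for every $x\in\mathcal{M}$, such that for every $(x,v)\in\mathcal{S}$ the curve $c(t)=\mathcal{R}_x(tv):=\mathcal{R}(x,tv)$ satisfies $c(0)=x$ and $\dot c(0)=v$. For $\rho>0$ write $B_x(\rho)=\{\mathcal{R}_x(\xi): \xi\in T_x\mathcal{M},\ \|\xi\|_x<\rho\}$. Let $\nabla f$ denote the Riemannian gradient and $\nabla^2 f$ the Riemannian Hessian (the Levi-Civita covariant derivative of $\nabla f$); $\nabla^2 f(x)>0$ means that $\langle \nabla^2 f(x)[v],v\rangle_x>0$ for all $0\ne v\in T_x\mathcal{M}$. Let $f:\mathcal{M}\to\mathbb{R}$ be smooth and let $x^*\in\mathcal{M}$ satisfy $\nabla f(x^*)=0$ and $\nabla^2 f(x^*)>0$. Then there exists $\rho>0$ such that $(x^*,\xi)\in\mathcal{S}$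 whenever $\|\xi\|_{x^*}\le\rho$ and such that $\nabla^2 f(y)>0$ for every $y$ in the closed retraction ball $\mathcal{D}:=\overline{B_{x^*}(\rho)}$, and there exists a level $M>f(x^*)$ (so $M>0$ if $f(x^*)\ge 0$) such that $\mathcal{D}$ contains the connected component containing $x^*$ of the sublevel set $\{y\in\mathcal{M}: f(y)\le M\}$. -/

import Mathlib

open Bundle
open scoped Manifold ContDiff Topology

namespace RiemGeom

section LeviCivita

variable {E : Type*} [NormedAddCommGroup E] [NormedSpace ℝ E]
  {M : Type*} [TopologicalSpace M] [ChartedSpace E M]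

lemma finiteDimensional_tangentSpace [FiniteDimensional ℝ E] (x : M) :
    FiniteDimensional ℝ (TangentSpace 𝓘(ℝ, E) x) :=
  inferInstanceAs (FiniteDimensional ℝ E)

variable [RiemannianBundle (fun x : M => TangentSpace 𝓘(ℝ, E) x)]

lemma completeSpace_tangentSpace [FiniteDimensional ℝ E] (x : M) :
    CompleteSpace (TangentSpace 𝓘(ℝ, E) x) :=
  haveI := finiteDimensional_tangentSpace (E := E) x
  FiniteDimensional.complete ℝ (TangentSpace 𝓘(ℝ, E) x)

/-- The tangent vector representing a covector with respect to the Riemannian metric. -/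
noncomputable def sharp [FiniteDimensional ℝ E] (x : M)
    (φ : TangentSpace 𝓘(ℝ, E) x →L[ℝ] ℝ) : TangentSpace 𝓘(ℝ, E) x :=
  haveI := completeSpace_tangentSpace (E := E) x
  (InnerProductSpace.toDual ℝ (TangentSpace 𝓘(ℝ, E) x)).symm φ

@[simp] lemma inner_sharp [FiniteDimensional ℝ E] {x : M}
    (φ : TangentSpace 𝓘(ℝ, E) x →L[ℝ] ℝ) (w : TangentSpace 𝓘(ℝ, E) x) :
    inner ℝ (sharp x φ) w = φ w := by
  have := completeSpace_tangentSpace (E := E) x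
  exact InnerProductSpace.toDual_symm_apply

lemma sharp_add [FiniteDimensional ℝ E] {x : M}
    (φ ψ : TangentSpace 𝓘(ℝ, E) x →L[ℝ] ℝ) :
    sharp x (φ + ψ) = sharp x φ + sharp x ψ := by
  refine ext_inner_right ℝ fun w => ?_
  simp [inner_add_left]

lemma sharp_smul [FiniteDimensional ℝ E] {x : M}
    (c : ℝ) (φ : TangentSpace 𝓘(ℝ, E) x →L[ℝ] ℝ) :
    sharp x (c • φ) = c • sharp x φ := by
  refine ext_inner_right ℝ fun w => ?_
  simp [inner_smul_left]

/-- The value at `x` of the right-hand side of the Koszul formula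
`⟨∇_X Y, Z⟩ = 1/2 (X⟨Y, Z⟩ + Y⟨Z, X⟩ - Z⟨X, Y⟩ + ⟨[X, Y], Z⟩ - ⟨[X, Z], Y⟩ - ⟨[Y, Z], X⟩)`. -/
noncomputable def koszul (X Y Z : Π x : M, TangentSpace 𝓘(ℝ, E) x) (x : M) : ℝ :=
  (1 / 2 : ℝ) *
    (d% (fun y => inner ℝ (Y y) (Z y)) x (X x)
      + d% (fun y => inner ℝ (Z y) (X y)) x (Y x)
      - d% (fun y => inner ℝ (X y) (Y y)) x (Z x)
      + inner ℝ (VectorField.mlieBracket 𝓘(ℝ, E) X Y x) (Z x)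
      - inner ℝ (VectorField.mlieBracket 𝓘(ℝ, E) X Z x) (Y x)
      - inner ℝ (VectorField.mlieBracket 𝓘(ℝ, E) Y Z x) (X x))

variable [IsManifold 𝓘(ℝ, E) ∞ M]
  [IsContMDiffRiemannianBundle 𝓘(ℝ, E) ∞ E (fun x : M => TangentSpace 𝓘(ℝ, E) x)]
  {X X' Y Y' Z Z' : Π x : M, TangentSpace 𝓘(ℝ, E) x} {x : M}

lemma mdifferentiableAt_inner_vectorField (hY : MDiffAt (T% Y) x) (hZ : MDiffAt (T% Z) x) :
    MDiffAt (fun y => inner ℝ (Y y) (Z y)) x :=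
  MDifferentiableAt.inner_bundle (F := E) (E := fun x : M => TangentSpace 𝓘(ℝ, E) x) hY hZ

variable [FiniteDimensional ℝ E]

lemma koszul_tensorial_left (hY : MDiffAt (T% Y) x) (hZ : MDiffAt (T% Z) x) :
    TensorialAt 𝓘(ℝ, E) E (fun X => koszul X Y Z x) x where
  smul {f X} hf hX := by
    have := FiniteDimensional.complete ℝ E
    have hXY := mdifferentiableAt_inner_vectorField hX hY
    have hZX := mdifferentiableAt_inner_vectorField hZ hX
    have e1 : (fun y => inner ℝ (Z y) ((f • X) y)) = f * (fun y => inner ℝ (Z y) (X y)) := by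
      ext y; simp [inner_smul_right]
    have e2 : (fun y => inner ℝ ((f • X) y) (Y y)) = f * (fun y => inner ℝ (X y) (Y y)) := by
      ext y; simp [inner_smul_left]
    simp only [koszul, e1, e2, mvfderiv_mul hf hZX, mvfderiv_mul hf hXY,
      VectorField.mlieBracket_smul_left hf hX]
    simp [inner_add_left, inner_smul_left, inner_smul_right]
    rw [real_inner_comm (X x) (Z x)]
    ring
  add {X X'} hX hX' := by
    have := FiniteDimensional.complete ℝ E
    have e1 : (fun y => inner ℝ (Z y) ((X + X') y))
        = (fun y => inner ℝ (Z y) (X y)) + (fun y => inner ℝ (Z y) (X' y)) := by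
      ext y; simp [inner_add_right]
    have e2 : (fun y => inner ℝ ((X + X') y) (Y y))
        = (fun y => inner ℝ (X y) (Y y)) + (fun y => inner ℝ (X' y) (Y y)) := by
      ext y; simp [inner_add_left]
    simp only [koszul, e1, e2, mvfderiv_add (mdifferentiableAt_inner_vectorField hZ hX) (mdifferentiableAt_inner_vectorField hZ hX'),
      mvfderiv_add (mdifferentiableAt_inner_vectorField hX hY) (mdifferentiableAt_inner_vectorField hX' hY),
      VectorField.mlieBracket_add_left hX hX']
    simp [inner_add_left, inner_add_right]
    ring

lemma koszul_tensorial_right (hX : MDiffAt (T% X) x) (hY : MDiffAt (T% Y) x) :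
    TensorialAt 𝓘(ℝ, E) E (fun Z => koszul X Y Z x) x where
  smul {f Z} hf hZ := by
    have := FiniteDimensional.complete ℝ E
    have hYZ := mdifferentiableAt_inner_vectorField hY hZ
    have hZX := mdifferentiableAt_inner_vectorField hZ hX
    have e1 : (fun y => inner ℝ (Y y) ((f • Z) y)) = f * (fun y => inner ℝ (Y y) (Z y)) := by
      ext y; simp [inner_smul_right]
    have e2 : (fun y => inner ℝ ((f • Z) y) (X y)) = f * (fun y => inner ℝ (Z y) (X y)) := by
      ext y; simp [inner_smul_left]
    simp only [koszul, e1, e2, mvfderiv_mul hf hZX, mvfderiv_mul hf hYZ,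
      VectorField.mlieBracket_smul_right hf hZ]
    simp [inner_add_left, inner_smul_left, inner_smul_right]
    rw [real_inner_comm (Z x) (Y x)]
    ring
  add {Z Z'} hZ hZ' := by
    have := FiniteDimensional.complete ℝ E
    have e1 : (fun y => inner ℝ (Y y) ((Z + Z') y))
        = (fun y => inner ℝ (Y y) (Z y)) + (fun y => inner ℝ (Y y) (Z' y)) := by
      ext y; simp [inner_add_right]
    have e2 : (fun y => inner ℝ ((Z + Z') y) (X y))
        = (fun y => inner ℝ (Z y) (X y)) + (fun y => inner ℝ (Z' y) (X y)) := by
      ext y; simp [inner_add_left]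
    simp only [koszul, e1, e2, mvfderiv_add (mdifferentiableAt_inner_vectorField hY hZ) (mdifferentiableAt_inner_vectorField hY hZ'),
      mvfderiv_add (mdifferentiableAt_inner_vectorField hZ hX) (mdifferentiableAt_inner_vectorField hZ' hX),
      VectorField.mlieBracket_add_right hZ hZ']
    simp [inner_add_left, inner_add_right]
    ring

/-- The Koszul formula only involves the values of `X` and `Z` at `x`: the bilinear form
`(X x, Z x) ↦ ⟨∇_X Y, Z⟩ x` on the tangent space at `x`. -/
noncomputable def koszulForm (hY : MDiffAt (T% Y) x) :
    TangentSpace 𝓘(ℝ, E) x →L[ℝ] TangentSpace 𝓘(ℝ, E) x →L[ℝ] ℝ :=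
  TensorialAt.mkHom₂ (I := 𝓘(ℝ, E)) (F := E) (F' := E) (fun X Z => koszul X Y Z x) x
    (fun _ hZ => koszul_tensorial_left hY hZ) (fun _ hX => koszul_tensorial_right hX hY)

open Classical in
/-- The map `v ↦ ∇_v Y` determined by the Koszul formula, with value `0` at points where the vector
field `Y` is not differentiable. -/
noncomputable def leviCivitaAux (Y : Π x : M, TangentSpace 𝓘(ℝ, E) x) (x : M) :
    TangentSpace 𝓘(ℝ, E) x →L[ℝ] TangentSpace 𝓘(ℝ, E) x :=
  haveI := finiteDimensional_tangentSpace (E := E) x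
  if hY : MDiffAt (T% Y) x then
    LinearMap.toContinuousLinearMap
      { toFun := fun v => sharp x (koszulForm hY v)
        map_add' := fun v w => by rw [map_add, sharp_add]
        map_smul' := fun c v => by rw [map_smul, sharp_smul, RingHom.id_apply] }
  else 0

lemma inner_leviCivitaAux (hX : MDiffAt (T% X) x) (hY : MDiffAt (T% Y) x)
    (hZ : MDiffAt (T% Z) x) :
    inner ℝ (leviCivitaAux Y x (X x)) (Z x) = koszul X Y Z x := by
  have h : leviCivitaAux Y x (X x) = sharp x (koszulForm hY (X x)) := by
    simp [leviCivitaAux, hY]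
  rw [h, inner_sharp]
  exact TensorialAt.mkHom₂_apply _ _ hX hZ

lemma koszul_add_middle (hX : MDiffAt (T% X) x) (hY : MDiffAt (T% Y) x)
    (hY' : MDiffAt (T% Y') x) (hZ : MDiffAt (T% Z) x) :
    koszul X (Y + Y') Z x = koszul X Y Z x + koszul X Y' Z x := by
  have := FiniteDimensional.complete ℝ E
  have e1 : (fun y => inner ℝ ((Y + Y') y) (Z y))
      = (fun y => inner ℝ (Y y) (Z y)) + (fun y => inner ℝ (Y' y) (Z y)) := by
    ext y; simp [inner_add_left]
  have e2 : (fun y => inner ℝ (X y) ((Y + Y') y))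
      = (fun y => inner ℝ (X y) (Y y)) + (fun y => inner ℝ (X y) (Y' y)) := by
    ext y; simp [inner_add_right]
  simp only [koszul, e1, e2,
    mvfderiv_add (mdifferentiableAt_inner_vectorField hY hZ)
      (mdifferentiableAt_inner_vectorField hY' hZ),
    mvfderiv_add (mdifferentiableAt_inner_vectorField hX hY)
      (mdifferentiableAt_inner_vectorField hX hY'),
    VectorField.mlieBracket_add_left hY hY', VectorField.mlieBracket_add_right hY hY']
  simp [inner_add_left, inner_add_right]
  ring

lemma koszul_smul_middle {f : M → ℝ} (hf : MDiffAt f x) (hX : MDiffAt (T% X) x)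
    (hY : MDiffAt (T% Y) x) (hZ : MDiffAt (T% Z) x) :
    koszul X (f • Y) Z x = f x * koszul X Y Z x + d% f x (X x) * inner ℝ (Y x) (Z x) := by
  have := FiniteDimensional.complete ℝ E
  have e1 : (fun y => inner ℝ ((f • Y) y) (Z y)) = f * (fun y => inner ℝ (Y y) (Z y)) := by
    ext y; simp [inner_smul_left]
  have e2 : (fun y => inner ℝ (X y) ((f • Y) y)) = f * (fun y => inner ℝ (X y) (Y y)) := by
    ext y; simp [inner_smul_right]
  simp only [koszul, e1, e2, mvfderiv_mul hf (mdifferentiableAt_inner_vectorField hY hZ),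
    mvfderiv_mul hf (mdifferentiableAt_inner_vectorField hX hY),
    VectorField.mlieBracket_smul_left hf hY, VectorField.mlieBracket_smul_right hf hY]
  simp [inner_add_left, inner_smul_left, inner_smul_right]
  rw [real_inner_comm (X x) (Y x)]
  ring

variable (E M) in
/-- The Levi-Civita connection, as a covariant derivative on the tangent bundle; `∇_v Y` at `x` is
`leviCivita E M Y x v`. -/
noncomputable def leviCivita :
    CovariantDerivative 𝓘(ℝ, E) E (fun x : M => TangentSpace 𝓘(ℝ, E) x) where
  toFun := leviCivitaAux
  isCovariantDerivativeOnUniv :=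
    { add := by
        intro Y Y' x hY hY' _
        ext1 v
        refine ext_inner_right ℝ fun w => ?_
        have hv := FiberBundle.mdifferentiableAt_extend 𝓘(ℝ, E) E v
        have hw := FiberBundle.mdifferentiableAt_extend 𝓘(ℝ, E) E w
        have hYY' := mdifferentiableAt_add_section hY hY'
        have h0 := inner_leviCivitaAux hv hYY' hw
        have h1 := inner_leviCivitaAux hv hY hw
        have h2 := inner_leviCivitaAux hv hY' hw
        have h3 := koszul_add_middle hv hY hY' hw
        simp only [FiberBundle.extend_apply_self] at h0 h1 h2 h3
        rw [add_apply, inner_add_left, h1, h2, ← h3]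
        exact h0
      leibniz := by
        intro Y f x hY hf _
        ext1 v
        refine ext_inner_right ℝ fun w => ?_
        have hv := FiberBundle.mdifferentiableAt_extend 𝓘(ℝ, E) E v
        have hw := FiberBundle.mdifferentiableAt_extend 𝓘(ℝ, E) E w
        have hfY := hf.smul_section hY
        have h0 := inner_leviCivitaAux hv hfY hw
        have h1 := inner_leviCivitaAux hv hY hw
        have h3 := koszul_smul_middle hf hv hY hw
        simp only [FiberBundle.extend_apply_self] at h0 h1 h3
        simp only [add_apply, smul_apply,
          ContinuousLinearMap.smulRight_apply, inner_add_left, inner_smul_left]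
        rw [h1]
        refine h0.trans (h3.trans ?_)
        simp }

/-- The Levi-Civita connection is torsion-free. -/
theorem leviCivita_torsion_free (hX : MDiffAt (T% X) x) (hY : MDiffAt (T% Y) x) :
    leviCivita E M Y x (X x) - leviCivita E M X x (Y x)
      = VectorField.mlieBracket 𝓘(ℝ, E) X Y x := by
  refine ext_inner_right ℝ fun w => ?_
  have hw := FiberBundle.mdifferentiableAt_extend 𝓘(ℝ, E) E w
  have h1 := inner_leviCivitaAux hX hY hw
  have h2 := inner_leviCivitaAux hY hX hw
  simp only [FiberBundle.extend_apply_self] at h1 h2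
  rw [inner_sub_left]
  change inner ℝ (leviCivitaAux Y x (X x)) w - inner ℝ (leviCivitaAux X x (Y x)) w = _
  rw [h1, h2]
  simp only [koszul, VectorField.mlieBracket_swap_apply (V := Y) (W := X),
    FiberBundle.extend_apply_self, inner_neg_left,
    fun y => real_inner_comm (Y y) (X y),
    fun y => real_inner_comm (FiberBundle.extend E w y) (X y),
    fun y => real_inner_comm (FiberBundle.extend E w y) (Y y)]
  ring

/-- The Levi-Civita connection is compatible with the metric. -/
theorem leviCivita_metric (hX : MDiffAt (T% X) x) (hY : MDiffAt (T% Y) x)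
    (hZ : MDiffAt (T% Z) x) :
    d% (fun y => inner ℝ (Y y) (Z y)) x (X x)
      = inner ℝ (leviCivita E M Y x (X x)) (Z x) + inner ℝ (Y x) (leviCivita E M Z x (X x)) := by
  have h1 := inner_leviCivitaAux hX hY hZ
  have h2 := inner_leviCivitaAux hX hZ hY
  rw [real_inner_comm (leviCivita E M Z x (X x)) (Y x)]
  change _ = inner ℝ (leviCivitaAux Y x (X x)) (Z x) + inner ℝ (leviCivitaAux Z x (X x)) (Y x)
  rw [h1, h2]
  simp only [koszul, VectorField.mlieBracket_swap_apply (V := Z) (W := Y), inner_neg_left,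
    fun y => real_inner_comm (Z y) (Y y),
    fun y => real_inner_comm (Z y) (X y),
    fun y => real_inner_comm (Y y) (X y)]
  ring

/-- The Riemannian gradient: `⟨∇f(x), v⟩ = df_x(v)`. -/
noncomputable def riemannianGradient (f : M → ℝ) (x : M) : TangentSpace 𝓘(ℝ, E) x :=
  sharp x (d% f x)

/-- The Riemannian Hessian `∇²f(x)[v] = ∇_v ∇f`. -/
noncomputable def riemannianHessian (f : M → ℝ) (x : M) :
    TangentSpace 𝓘(ℝ, E) x →L[ℝ] TangentSpace 𝓘(ℝ, E) x :=
  leviCivita E M (riemannianGradient f) x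

variable (E) in
/-- `∇²f(x) > 0`: the Riemannian Hessian of `f` at `x` is positive definite. -/
def HessianPosDef (f : M → ℝ) (x : M) : Prop :=
  ∀ v : TangentSpace 𝓘(ℝ, E) x, v ≠ 0 → 0 < inner ℝ (riemannianHessian f x v) v

end LeviCivita

section Retraction

variable (E : Type*) [NormedAddCommGroup E] [NormedSpace ℝ E]
  (M : Type*) [TopologicalSpace M] [ChartedSpace E M] [IsManifold 𝓘(ℝ, E) ∞ M]

/-- A retraction on `M`, defined on an open subset `domain` of the tangent bundle; `toFun` has no
meaning outside of `domain`. -/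
structure Retraction where
  domain : Set (TangentBundle 𝓘(ℝ, E) M)
  toFun : TangentBundle 𝓘(ℝ, E) M → M
  isOpen_domain : IsOpen domain
  zero_mem : ∀ x : M, (⟨x, 0⟩ : TangentBundle 𝓘(ℝ, E) M) ∈ domain
  contMDiffOn : ContMDiffOn 𝓘(ℝ, E).tangent 𝓘(ℝ, E) ∞ toFun domain
  /-- For `p = (x, v)` the curve `c(t) = R(x, t v)` has `(c(0), c'(0)) = (x, v)`. -/
  tangentMap_curve : ∀ p ∈ domain,
    tangentMap 𝓘(ℝ, ℝ) 𝓘(ℝ, E) (fun t : ℝ => toFun ⟨p.1, t • p.2⟩) ⟨0, (1 : ℝ)⟩ = p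

variable {E M} [RiemannianBundle (fun x : M => TangentSpace 𝓘(ℝ, E) x)]

/-- The open retraction ball `B_x(ρ) = {R_x(ξ) : ‖ξ‖_x < ρ}`. -/
def Retraction.ball (R : Retraction E M) (x : M) (ρ : ℝ) : Set M :=
  {y | ∃ ξ : TangentSpace 𝓘(ℝ, E) x, (⟨x, ξ⟩ : TangentBundle 𝓘(ℝ, E) M) ∈ R.domain ∧
    ‖ξ‖ < ρ ∧ R.toFun ⟨x, ξ⟩ = y}

end Retraction

end RiemGeom

/-! Three local facts at the nondegenerate critical point combine. Positivity of the Hessian is an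
open condition (`eventually_hessianPosDef`): in a local frame the coefficients of the Hessian form
are values of `koszul`, hence continuous, and positivity of a quadratic form survives small changes
of its coefficients. The map `ξ ↦ R_x(ξ)` has identity differential at the origin, so small
retraction balls are neighbourhoods of `x`. The image of a small closed ball is compact, hence
closed, so the closure of the retraction ball stays where the Hessian is positive
(`Retraction.exists_ball_mem_nhds`). At a critical point the Hessian form is the second derivative
in a chart, so `x` is a strict local minimum (`eventually_lt_of_hessianPosDef`). On the boundary of
a compact neighbourhood inside the ball, `f` is therefore bounded below by some level above `f x`,
and a connected piece of the sublevel set starting at `x` cannot cross that boundary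
(`exists_connectedComponentIn_sublevel_subset`). -/

namespace RiemGeom

/-! ### Gradient coefficients by Cramer's rule -/

section Determinant

variable {E : Type*} [NormedAddCommGroup E] [NormedSpace ℝ E]
  {M : Type*} [TopologicalSpace M] [ChartedSpace E M] {u : Set M}

lemma contMDiffOn_det {ι : Type*} [Fintype ι] [DecidableEq ι] {A : M → Matrix ι ι ℝ}
    (hA : ∀ i j, ContMDiffOn 𝓘(ℝ, E) 𝓘(ℝ, ℝ) ∞ (fun y => A y i j) u) :
    ContMDiffOn 𝓘(ℝ, E) 𝓘(ℝ, ℝ) ∞ (fun y => (A y).det) u := by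
  simp only [Matrix.det_apply']
  exact contMDiffOn_finsetSum fun σ _ =>
    contMDiffOn_const.mul (contMDiffOn_finsetProd fun i _ => hA (σ i) i)

end Determinant

section Gradient

variable {E : Type*} [NormedAddCommGroup E] [NormedSpace ℝ E] [FiniteDimensional ℝ E]
  {M : Type*} [TopologicalSpace M] [ChartedSpace E M]
  [RiemannianBundle (fun x : M => TangentSpace 𝓘(ℝ, E) x)]

@[simp] lemma inner_riemannianGradient (f : M → ℝ) {x : M} (v : TangentSpace 𝓘(ℝ, E) x) :
    inner ℝ (riemannianGradient f x) v = d% f x v :=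
  inner_sharp _ v

/-- Pairing with the basis gives a linear system whose matrix is the Gram matrix. Cramer's rule
writes the solution as a quotient of determinants, a form in which smooth dependence on the base
point is visible. -/
lemma riemannianGradient_eq_sum {ι : Type*} [Fintype ι] [DecidableEq ι] {x : M} (f : M → ℝ)
    (b : Module.Basis ι ℝ (TangentSpace 𝓘(ℝ, E) x)) :
    riemannianGradient f x
      = ∑ i, ((Matrix.gram ℝ b).det⁻¹ *
          (Matrix.cramer (Matrix.gram ℝ b) fun j => d% f x (b j)) i) • b i := by
  have hdet : (Matrix.gram ℝ b).det ≠ 0 :=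
    (Matrix.posDef_gram_of_linearIndependent b.linearIndependent).det_pos.ne'
  set c := fun i => (Matrix.gram ℝ b).det⁻¹ *
    (Matrix.cramer (Matrix.gram ℝ b) fun j => d% f x (b j)) i
  have hc : (Matrix.gram ℝ b).mulVec c = fun j => d% f x (b j) := by
    have e : c = (Matrix.gram ℝ b).det⁻¹ •
      Matrix.cramer (Matrix.gram ℝ b) fun j => d% f x (b j) := rfl
    rw [e, Matrix.mulVec_smul, Matrix.mulVec_cramer, smul_smul, inv_mul_cancel₀ hdet, one_smul]
  refine InnerProductSpace.ext_inner_left_basis b fun j => ?_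
  rw [real_inner_comm, inner_riemannianGradient, ← congrFun hc j, inner_sum]
  simp only [Matrix.mulVec, dotProduct, Matrix.gram_apply, inner_smul_right, mul_comm]
  rfl

end Gradient

/-! ### Smoothness of the gradient and of the Koszul expression -/

section Smoothness

variable {E : Type*} [NormedAddCommGroup E] [NormedSpace ℝ E]
  {M : Type*} [TopologicalSpace M] [ChartedSpace E M] [IsManifold 𝓘(ℝ, E) ∞ M]
  {u : Set M}

/-- The function is the fibre component of the tangent map of `g` composed with the section `X`. -/
lemma contMDiffOn_mvfderiv_apply (hu : IsOpen u) {g : M → ℝ}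
    {X : Π x : M, TangentSpace 𝓘(ℝ, E) x} (hg : CMDiff[u] ∞ g) (hX : CMDiff[u] ∞ (T% X)) :
    CMDiff[u] ∞ (fun y => d% g y (X y)) := by
  have h1 : ContMDiffOn 𝓘(ℝ, E).tangent 𝓘(ℝ, ℝ).tangent ∞
      (tangentMapWithin 𝓘(ℝ, E) 𝓘(ℝ, ℝ) g u) (π E (TangentSpace 𝓘(ℝ, E)) ⁻¹' u) :=
    hg.contMDiffOn_tangentMapWithin (by simp) hu.uniqueMDiffOn
  have h2 := (contMDiff_snd_tangentBundle_modelSpace (n := ∞) ℝ 𝓘(ℝ, ℝ)).comp_contMDiffOn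
    (h1.comp hX (fun y hy => hy))
  refine h2.congr fun y hy => ?_
  change d% g y (X y) = mfderivWithin 𝓘(ℝ, E) 𝓘(ℝ, ℝ) g u y (X y)
  rw [mfderivWithin_of_isOpen hu hy]
  rfl

lemma contMDiffOn_mlieBracket [CompleteSpace E] (hu : IsOpen u)
    {X Y : Π x : M, TangentSpace 𝓘(ℝ, E) x}
    (hX : CMDiff[u] ∞ (T% X)) (hY : CMDiff[u] ∞ (T% Y)) :
    CMDiff[u] ∞ (T% (VectorField.mlieBracket 𝓘(ℝ, E) X Y)) := fun y hy =>
  haveI : IsManifold 𝓘(ℝ, E) (minSmoothness ℝ 2) M := by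
    simpa using (inferInstance : IsManifold 𝓘(ℝ, E) 2 M)
  haveI : IsManifold 𝓘(ℝ, E) (((⊤ : ℕ∞) : ℕ∞ω) + 1) M :=
    inferInstanceAs (IsManifold 𝓘(ℝ, E) ∞ M)
  (ContMDiffAt.mlieBracket_vectorField (m := ⊤) (n := ⊤) (hX.contMDiffAt (hu.mem_nhds hy))
    (hY.contMDiffAt (hu.mem_nhds hy)) (by simp)).contMDiffWithinAt

variable [RiemannianBundle (fun x : M => TangentSpace 𝓘(ℝ, E) x)]
  [IsContMDiffRiemannianBundle 𝓘(ℝ, E) ∞ E (fun x : M => TangentSpace 𝓘(ℝ, E) x)]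

lemma contMDiffOn_inner {X Y : Π x : M, TangentSpace 𝓘(ℝ, E) x}
    (hX : CMDiff[u] ∞ (T% X)) (hY : CMDiff[u] ∞ (T% Y)) :
    CMDiff[u] ∞ (fun y => inner ℝ (X y) (Y y)) :=
  ContMDiffOn.inner_bundle (F := E) (E := fun x : M => TangentSpace 𝓘(ℝ, E) x) hX hY

lemma contMDiffOn_koszul [CompleteSpace E] (hu : IsOpen u)
    {X Y Z : Π x : M, TangentSpace 𝓘(ℝ, E) x} (hX : CMDiff[u] ∞ (T% X))
    (hY : CMDiff[u] ∞ (T% Y)) (hZ : CMDiff[u] ∞ (T% Z)) :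
    CMDiff[u] ∞ (koszul X Y Z) := by
  refine contMDiffOn_const.mul ?_
  exact ((((((contMDiffOn_mvfderiv_apply hu (contMDiffOn_inner hY hZ) hX).add
    (contMDiffOn_mvfderiv_apply hu (contMDiffOn_inner hZ hX) hY)).sub
    (contMDiffOn_mvfderiv_apply hu (contMDiffOn_inner hX hY) hZ)).add
    (contMDiffOn_inner (contMDiffOn_mlieBracket hu hX hY) hZ)).sub
    (contMDiffOn_inner (contMDiffOn_mlieBracket hu hX hZ) hY)).sub
    (contMDiffOn_inner (contMDiffOn_mlieBracket hu hY hZ) hX))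

variable [FiniteDimensional ℝ E]

/-- The gradient of a smooth function is smooth on the domain of a smooth frame. -/
lemma contMDiffOn_riemannianGradient {ι : Type*} [Fintype ι] [DecidableEq ι] (hu : IsOpen u)
    {s : ι → Π x : M, TangentSpace 𝓘(ℝ, E) x} (hs : IsLocalFrameOn 𝓘(ℝ, E) E ∞ s u) {f : M → ℝ}
    (hf : CMDiff[u] ∞ f) : CMDiff[u] ∞ (T% (riemannianGradient (E := E) f)) := by
  have hgram (i j : ι) : CMDiff[u] ∞ (fun y => Matrix.gram ℝ (fun i => s i y) i j) :=
    contMDiffOn_inner (hs.contMDiffOn i) (hs.contMDiffOn j)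
  have hb (j : ι) : CMDiff[u] ∞ (fun y => d% f y (s j y)) :=
    contMDiffOn_mvfderiv_apply hu hf (hs.contMDiffOn j)
  have hinv : CMDiff[u] ∞ (fun y => (Matrix.gram ℝ (fun i => s i y)).det⁻¹) := by
    refine (contMDiffOn_det hgram).inv₀ fun y hy => ?_
    exact (Matrix.posDef_gram_of_linearIndependent (hs.linearIndependent hy)).det_pos.ne'
  have hc (i : ι) : CMDiff[u] ∞ (fun y => (Matrix.cramer (Matrix.gram ℝ (fun i => s i y))
      fun j => d% f y (s j y)) i) := by
    simp only [Matrix.cramer_apply]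
    refine contMDiffOn_det fun k l => ?_
    simp only [Matrix.updateCol_apply]
    split_ifs
    · exact hb k
    · exact hgram k l
  have h : CMDiff[u] ∞ (T% (fun y => ∑ i, ((Matrix.gram ℝ (fun i => s i y)).det⁻¹ *
      (Matrix.cramer (Matrix.gram ℝ (fun i => s i y)) fun j => d% f y (s j y)) i) • s i y)) :=
    .sum_section fun i _ => (hinv.mul (hc i)).smul_section (hs.contMDiffOn i)
  refine h.congr fun y hy => ?_
  have := riemannianGradient_eq_sum f (hs.toBasisAt hy)
  simp only [hs.toBasisAt_coe] at this
  have e : ⇑(hs.toBasisAt hy) = fun i => s i y := by ext i; simp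
  rw [e] at this
  rw [this]

/-- Lets the continuity of Hessian coefficients be read off `koszul`, without a smoothness statement
for the connection itself. -/
lemma inner_riemannianHessian {f : M → ℝ} {X Z : Π x : M, TangentSpace 𝓘(ℝ, E) x} {x : M}
    (hf : MDiffAt (T% (riemannianGradient (E := E) f)) x) (hX : MDiffAt (T% X) x)
    (hZ : MDiffAt (T% Z) x) :
    inner ℝ (riemannianHessian f x (X x)) (Z x) = koszul X (riemannianGradient f) Z x :=
  inner_leviCivitaAux hX hf hZ

end Smoothness

/-- Positivity of a quadratic form is an open condition on its coefficients. -/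
lemma eventually_quadratic_pos {X ι : Type*} [TopologicalSpace X] [Fintype ι]
    {H : ι → ι → X → ℝ} {x : X} (hH : ∀ i j, ContinuousAt (H i j) x)
    (hpos : ∀ a : ι → ℝ, a ≠ 0 → 0 < ∑ i, ∑ j, a i * a j * H i j x) :
    ∀ᶠ y in 𝓝 x, ∀ a : ι → ℝ, a ≠ 0 → 0 < ∑ i, ∑ j, a i * a j * H i j y := by
  -- Compactness of the unit sphere makes the neighbourhood of `x` uniform in `a`; homogeneity of
  -- degree two then covers every nonzero `a`.
  have key : ∀ᶠ y in 𝓝 x, ∀ a ∈ Metric.sphere (0 : ι → ℝ) 1,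
      0 < ∑ i, ∑ j, a i * a j * H i j y := by
    refine (isCompact_sphere _ _).eventually_forall_of_forall_eventually fun a ha => ?_
    have hc : ContinuousAt (fun z : X × (ι → ℝ) => ∑ i, ∑ j, z.2 i * z.2 j * H i j z.1)
        (x, a) := by
      refine tendsto_finsetSum _ fun i _ => tendsto_finsetSum _ fun j _ => ?_
      have : ContinuousAt (fun z : X × (ι → ℝ) => H i j z.1) (x, a) :=
        ContinuousAt.comp (f := Prod.fst) (hH i j) continuousAt_fst
      exact ContinuousAt.mul (by fun_prop) this
    exact hc.eventually_const_lt (hpos a (by rintro rfl; simp at ha))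
  filter_upwards [key] with y hy a ha
  have hn : 0 < ‖a‖ := norm_pos_iff.2 ha
  have h := hy (‖a‖⁻¹ • a) (by simp [norm_smul, hn.ne'])
  have e : ∑ i, ∑ j, (‖a‖⁻¹ • a) i * (‖a‖⁻¹ • a) j * H i j y
      = ‖a‖⁻¹ ^ 2 * ∑ i, ∑ j, a i * a j * H i j y := by
    simp only [Finset.mul_sum, Pi.smul_apply, smul_eq_mul]
    exact Finset.sum_congr rfl fun i _ => Finset.sum_congr rfl fun j _ => by ring
  rw [e] at h
  exact pos_of_mul_pos_right h (by positivity)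

/-! ### Openness of positive definiteness -/

section Hessian

variable {E : Type*} [NormedAddCommGroup E] [NormedSpace ℝ E] [FiniteDimensional ℝ E]
  {M : Type*} [TopologicalSpace M] [ChartedSpace E M] [IsManifold 𝓘(ℝ, E) ∞ M]
  [RiemannianBundle (fun x : M => TangentSpace 𝓘(ℝ, E) x)]
  [IsContMDiffRiemannianBundle 𝓘(ℝ, E) ∞ E (fun x : M => TangentSpace 𝓘(ℝ, E) x)]

lemma inner_sum_sum {ι V : Type*} [Fintype ι] [NormedAddCommGroup V] [InnerProductSpace ℝ V]
    (A : V →L[ℝ] V) (b : ι → V) (a : ι → ℝ) :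
    inner ℝ (A (∑ i, a i • b i)) (∑ j, a j • b j)
      = ∑ i, ∑ j, a i * a j * inner ℝ (A (b i)) (b j) := by
  simp only [map_sum, map_smul, sum_inner]
  refine Finset.sum_congr rfl fun i _ => ?_
  rw [inner_sum]
  refine Finset.sum_congr rfl fun j _ => ?_
  rw [real_inner_smul_left, real_inner_smul_right, mul_assoc]

lemma hessianPosDef_iff {ι : Type*} [Fintype ι] {f : M → ℝ} {x : M}
    (b : Module.Basis ι ℝ (TangentSpace 𝓘(ℝ, E) x)) :
    HessianPosDef E f x ↔ ∀ a : ι → ℝ, a ≠ 0 →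
      0 < ∑ i, ∑ j, a i * a j * inner ℝ (riemannianHessian f x (b i)) (b j) := by
  simp only [← inner_sum_sum]
  constructor
  · intro h a ha
    refine h _ fun h0 => ha ?_
    exact funext (Fintype.linearIndependent_iff.1 b.linearIndependent a h0)
  · intro h v hv
    have := h (b.equivFun v) (by simpa using hv)
    simpa only [b.sum_equivFun] using this

lemma riemannianGradient_contMDiff {f : M → ℝ} (hf : CMDiff ∞ f) :
    CMDiff ∞ (T% (riemannianGradient (E := E) f)) := by
  classical
  intro x
  let e := trivializationAt E (TangentSpace 𝓘(ℝ, E) : M → Type _) x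
  have hx : x ∈ e.baseSet := FiberBundle.mem_baseSet_trivializationAt' x
  exact (contMDiffOn_riemannianGradient e.open_baseSet
    (e.isLocalFrameOn_localFrame_baseSet 𝓘(ℝ, E) ∞ (Module.finBasis ℝ E))
    hf.contMDiffOn).contMDiffAt (e.open_baseSet.mem_nhds hx)

/-- Positive definiteness of the Hessian is an open condition. -/
lemma eventually_hessianPosDef {f : M → ℝ} (hf : CMDiff ∞ f) {x : M}
    (hpos : HessianPosDef E f x) : ∀ᶠ y in 𝓝 x, HessianPosDef E f y := by
  let e := trivializationAt E (TangentSpace 𝓘(ℝ, E) : M → Type _) x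
  have hx : x ∈ e.baseSet := FiberBundle.mem_baseSet_trivializationAt' x
  set s := e.localFrame (Module.finBasis ℝ E)
  have hs := e.isLocalFrameOn_localFrame_baseSet 𝓘(ℝ, E) ∞ (Module.finBasis ℝ E)
  have hu := e.open_baseSet
  have hc := FiniteDimensional.complete ℝ E
  have hgrad := riemannianGradient_contMDiff (E := E) hf
  -- The left side is a smooth function of `y` on the whole base set; the right side is the
  -- coefficient that tests positivity at the single point `y`.
  have hH {y : M} (hy : y ∈ e.baseSet) (i j) :
      koszul (s i) (riemannianGradient f) (s j) y
        = inner ℝ (riemannianHessian f y (hs.toBasisAt hy i)) (hs.toBasisAt hy j) := by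
    rw [← inner_riemannianHessian (hgrad.mdifferentiableAt (by simp))
      ((hs.contMDiffAt hu hy i).mdifferentiableAt (by simp))
      ((hs.contMDiffAt hu hy j).mdifferentiableAt (by simp))]
    simp
  have hev := eventually_quadratic_pos (x := x)
    (H := fun i j => koszul (s i) (riemannianGradient f) (s j))
    (fun i j => (contMDiffOn_koszul hu (hs.contMDiffOn i) hgrad.contMDiffOn
      (hs.contMDiffOn j)).continuousOn.continuousAt (hu.mem_nhds hx))
    (by simpa only [hH hx] using (hessianPosDef_iff (hs.toBasisAt hx)).1 hpos)
  filter_upwards [hev, hu.mem_nhds hx] with y hy hyu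
  refine (hessianPosDef_iff (hs.toBasisAt hyu)).2 ?_
  simpa only [hH hyu] using hy

end Hessian

/-! ### Second derivative test and sublevel components -/

section LocalMin

/-- The constant is the minimum of the form on the compact unit sphere, extended by homogeneity. -/
lemma exists_pos_mul_sq_norm_le {E : Type*} [NormedAddCommGroup E] [NormedSpace ℝ E]
    [FiniteDimensional ℝ E] {A : E →L[ℝ] E →L[ℝ] ℝ} (hA : ∀ e, e ≠ 0 → 0 < A e e) :
    ∃ c : ℝ, 0 < c ∧ ∀ e, c * ‖e‖ ^ 2 ≤ A e e := by
  rcases (Metric.sphere (0 : E) 1).eq_empty_or_nonempty with hs | hs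
  -- An empty unit sphere means that `E` is trivial, so any constant works.
  · refine ⟨1, one_pos, fun e => ?_⟩
    have he : e = 0 := by
      by_contra he
      have : ‖e‖⁻¹ • e ∈ Metric.sphere (0 : E) 1 := by simp [norm_smul, he]
      simp [hs] at this
    simp [he]
  · obtain ⟨e₀, he₀, hmin⟩ := (isCompact_sphere (0 : E) 1).exists_isMinOn hs
      (f := fun e => A e e) (A.continuous.clm_apply continuous_id).continuousOn
    refine ⟨A e₀ e₀, hA e₀ (by rintro rfl; simp at he₀), fun e => ?_⟩
    by_cases he : e = 0
    · simp [he]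
    have hn : 0 < ‖e‖ := norm_pos_iff.2 he
    have h : A e₀ e₀ ≤ A (‖e‖⁻¹ • e) (‖e‖⁻¹ • e) :=
      hmin (by simp [norm_smul, he] : ‖e‖⁻¹ • e ∈ Metric.sphere (0 : E) 1)
    calc A e₀ e₀ * ‖e‖ ^ 2 ≤ A (‖e‖⁻¹ • e) (‖e‖⁻¹ • e) * ‖e‖ ^ 2 := by gcongr
      _ = A e e := by simp; field_simp

/-- The second derivative test for a strict local minimum. -/
lemma eventually_lt_of_fderiv_fderiv_pos {E : Type*} [NormedAddCommGroup E] [NormedSpace ℝ E]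
    [FiniteDimensional ℝ E] {g : E → ℝ} {p : E} {A : E →L[ℝ] E →L[ℝ] ℝ}
    (hg : ∀ᶠ y in 𝓝 p, DifferentiableAt ℝ g y) (hA : HasFDerivAt (fderiv ℝ g) A p)
    (hcrit : fderiv ℝ g p = 0) (hpos : ∀ e, e ≠ 0 → 0 < A e e) :
    ∀ᶠ y in 𝓝 p, y ≠ p → g p < g y := by
  obtain ⟨c, hc, hcA⟩ := exists_pos_mul_sq_norm_le hpos
  -- An error of at most `c / 2` per unit length leaves the derivative along the segment, at time
  -- `t`, at least `t * c / 2 * ‖h‖ ^ 2`.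
  have ho := hA.isLittleO.def (half_pos hc)
  obtain ⟨δ, hδ, hball⟩ := Metric.eventually_nhds_iff_ball.1 (hg.and ho)
  filter_upwards [Metric.ball_mem_nhds p hδ] with y hy hne
  set h := y - p with hh
  have hh0 : 0 < ‖h‖ := norm_pos_iff.2 (sub_ne_zero.2 hne)
  have hmem {t : ℝ} (ht : t ∈ Set.Icc (0 : ℝ) 1) : p + t • h ∈ Metric.ball p δ := by
    rw [mem_ball_iff_norm] at hy ⊢
    rw [add_sub_cancel_left, norm_smul, Real.norm_of_nonneg ht.1]
    exact (mul_le_of_le_one_left hh0.le ht.2).trans_lt hy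
  have hderiv {t : ℝ} (ht : t ∈ Set.Icc (0 : ℝ) 1) :
      HasDerivAt (fun t : ℝ => g (p + t • h)) (fderiv ℝ g (p + t • h) h) t := by
    have h1 : HasDerivAt (fun t : ℝ => p + t • h) h t := by
      simpa using ((hasDerivAt_id t).smul_const h).const_add p
    exact (hball _ (hmem ht)).1.hasFDerivAt.comp_hasDerivAt t h1
  -- Strict monotonicity along the segment from `p` to `y` replaces a Taylor expansion of order two.
  have hmono : StrictMonoOn (fun t : ℝ => g (p + t • h)) (Set.Icc 0 1) := by
    refine strictMonoOn_of_deriv_pos (convex_Icc 0 1)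
      (fun t ht => (hderiv ht).continuousAt.continuousWithinAt) fun t ht => ?_
    have ht' : t ∈ Set.Icc (0 : ℝ) 1 := interior_subset ht
    rw [interior_Icc] at ht
    rw [(hderiv ht').deriv]
    have h1 := (hball _ (hmem ht')).2
    rw [hcrit, sub_zero, add_sub_cancel_left] at h1
    have h2 : |(fderiv ℝ g (p + t • h) - A (t • h)) h| ≤ c / 2 * ‖t • h‖ * ‖h‖ :=
      ((fderiv ℝ g (p + t • h) - A (t • h)).le_opNorm h).trans (by gcongr)
    have h3 := (abs_le.1 h2).1
    simp only [sub_apply, map_smul, smul_apply, smul_eq_mul, norm_smul,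
      Real.norm_of_nonneg ht'.1] at h3
    have h4 := mul_le_mul_of_nonneg_left (hcA h) ht'.1
    have h5 : 0 < t * (c * ‖h‖ ^ 2) := mul_pos ht.1 (by positivity)
    nlinarith
  simpa [hh] using hmono (by simp) (by simp) one_pos

/-- Around a strict local minimum, small sublevel sets have small connected components. -/
lemma exists_connectedComponentIn_sublevel_subset {X : Type*} [TopologicalSpace X] [T2Space X]
    [LocallyCompactSpace X] {f : X → ℝ} (hf : Continuous f) {x : X}
    (hmin : ∀ᶠ y in 𝓝 x, y ≠ x → f x < f y) {N : Set X} (hN : N ∈ 𝓝 x) :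
    ∃ c : ℝ, f x < c ∧ connectedComponentIn {y | f y ≤ c} x ⊆ N := by
  obtain ⟨K, hKx, hKN, hK⟩ := local_compact_nhds (Filter.inter_mem hN hmin)
  have hxK : x ∈ interior K := mem_interior_iff_mem_nhds.2 hKx
  have hfr : IsCompact (K \ interior K) := hK.diff isOpen_interior
  have hlt : ∀ y ∈ K \ interior K, f x < f y := fun y hy =>
    (hKN hy.1).2 (by rintro rfl; exact hy.2 hxK)
  -- `K \ interior K` is the frontier of the closed set `K`. The level lies strictly below the
  -- minimum of `f` there, so the sublevel set misses it; if it is empty, any level above `f x` will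
  -- do.
  obtain ⟨c, hc, hcK⟩ : ∃ c, f x < c ∧ ∀ y ∈ K \ interior K, c < f y := by
    rcases (K \ interior K).eq_empty_or_nonempty with h | h
    · exact ⟨f x + 1, by simp, by simp [h]⟩
    · obtain ⟨y₀, hy₀, hm⟩ := hfr.exists_isMinOn h hf.continuousOn
      obtain ⟨c, hc1, hc2⟩ := exists_between (hlt y₀ hy₀)
      exact ⟨c, hc1, fun y hy => hc2.trans_le (hm hy)⟩
  refine ⟨c, hc, ?_⟩
  have hsub : connectedComponentIn {y | f y ≤ c} x ⊆ interior K ∪ Kᶜ := by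
    intro y hy
    by_contra hy'
    simp only [Set.mem_union, Set.mem_compl_iff, not_or, not_not] at hy'
    have hyc : f y ≤ c := connectedComponentIn_subset {y | f y ≤ c} x hy
    exact (hcK y ⟨hy'.2, hy'.1⟩).not_ge hyc
  -- The component is covered by the disjoint open sets `interior K` and `Kᶜ` and meets the first at
  -- `x`.
  refine (isPreconnected_connectedComponentIn.subset_left_of_subset_union isOpen_interior
    hK.isClosed.isOpen_compl (disjoint_compl_right.mono_left interior_subset) hsub
    ⟨x, mem_connectedComponentIn (by simpa using hc.le), hxK⟩).trans ?_
  exact fun y hy => (hKN (interior_subset hy)).1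

end LocalMin

/-! ### The Hessian at a critical point in a chart -/

section CriticalPoint

variable {E : Type*} [NormedAddCommGroup E] [NormedSpace ℝ E]
  {M : Type*} [TopologicalSpace M] [ChartedSpace E M] [IsManifold 𝓘(ℝ, E) ∞ M]

lemma contDiffAt_comp_extChartAt_symm {f : M → ℝ} (hf : CMDiff ∞ f) {x : M} {q : E}
    (hq : q ∈ (extChartAt 𝓘(ℝ, E) x).target) :
    ContDiffAt ℝ ∞ (f ∘ (extChartAt 𝓘(ℝ, E) x).symm) q := by
  rw [← contMDiffAt_iff_contDiffAt]
  exact ContMDiffAt.comp q hf.contMDiffAt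
    ((contMDiffOn_extChartAt_symm x).contMDiffAt ((isOpen_extChartAt_target x).mem_nhds hq))

/-- The derivative of `f` along a coordinate vector field. -/
lemma mvfderiv_trivializationAt_symmL {f : M → ℝ} (hf : CMDiff ∞ f) {x y : M}
    (hy : y ∈ (extChartAt 𝓘(ℝ, E) x).source) (w : E) :
    d% f y ((trivializationAt E (TangentSpace 𝓘(ℝ, E)) x).symmL ℝ y w)
      = fderiv ℝ (f ∘ (extChartAt 𝓘(ℝ, E) x).symm) (extChartAt 𝓘(ℝ, E) x y) w := by
  have hy' : y ∈ (chartAt E x).source := by simpa using hy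
  -- The coordinate vector is the image of `w` under the differential of the inverse chart, which
  -- reduces the claim to the chain rule.
  have h1 : (trivializationAt E (TangentSpace 𝓘(ℝ, E)) x).symmL ℝ y w
      = mfderiv 𝓘(ℝ, E) 𝓘(ℝ, E) (extChartAt 𝓘(ℝ, E) x).symm (extChartAt 𝓘(ℝ, E) x y) w := by
    have := TangentBundle.symmL_trivializationAt (𝕜 := ℝ) (I := 𝓘(ℝ, E)) hy'
    rw [modelWithCornersSelf_coe, Set.range_id, mfderivWithin_univ] at this
    exact DFunLike.congr_fun this w
  have hφ := mdifferentiableWithinAt_extChartAt_symm (I := 𝓘(ℝ, E))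
    ((extChartAt 𝓘(ℝ, E) x).map_source hy)
  rw [modelWithCornersSelf_coe, Set.range_id, mdifferentiableWithinAt_univ] at hφ
  have h2 := mvfderiv_comp_apply_of_eq (g := f) (extChartAt 𝓘(ℝ, E) x y)
    (hf.mdifferentiable (by simp) y) hφ ((extChartAt 𝓘(ℝ, E) x).left_inv hy) w
  rw [h1]
  refine h2.symm.trans ?_
  simp only [mvfderiv, mfderiv_eq_fderiv]
  rfl

variable [FiniteDimensional ℝ E]
  [RiemannianBundle (fun x : M => TangentSpace 𝓘(ℝ, E) x)]
  [IsContMDiffRiemannianBundle 𝓘(ℝ, E) ∞ E (fun x : M => TangentSpace 𝓘(ℝ, E) x)]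

/-- At a critical point the Hessian is the second derivative in a chart. -/
lemma inner_riemannianHessian_of_gradient_eq_zero {f : M → ℝ} (hf : CMDiff ∞ f) {x : M}
    (hcrit : riemannianGradient (E := E) f x = 0) (w : E) :
    inner ℝ (riemannianHessian f x ((trivializationAt E (TangentSpace 𝓘(ℝ, E)) x).symmL ℝ x w))
        ((trivializationAt E (TangentSpace 𝓘(ℝ, E)) x).symmL ℝ x w)
      = fderiv ℝ (fderiv ℝ (f ∘ (extChartAt 𝓘(ℝ, E) x).symm)) (extChartAt 𝓘(ℝ, E) x x) w w := by
  let e := trivializationAt E (TangentSpace 𝓘(ℝ, E) : M → Type _) x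
  have hxe : x ∈ e.baseSet := FiberBundle.mem_baseSet_trivializationAt' x
  set φ := extChartAt 𝓘(ℝ, E) x
  set g := f ∘ φ.symm
  -- The coordinate vector field with constant components `w`.
  let X : Π y : M, TangentSpace 𝓘(ℝ, E) y := fun y => e.symmL ℝ y w
  have hX : MDiffAt (T% X) x := by
    refine ContMDiffAt.mdifferentiableAt (n := 1) ?_ one_ne_zero
    rw [e.contMDiffAt_section_iff hxe]
    refine (contMDiffAt_const (c := w)).congr_of_eventuallyEq ?_
    filter_upwards [e.open_baseSet.mem_nhds hxe] with y hy
    simp only [X]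
    rw [e.symmL_apply (R := ℝ) hy, e.apply_mk_symm hy]
  have hgrad : MDiffAt (T% (riemannianGradient (E := E) f)) x :=
    (riemannianGradient_contMDiff hf).mdifferentiableAt (by simp)
  -- Metric compatibility gives `X⟨∇f, X⟩ = ⟨∇_X ∇f, X⟩ + ⟨∇f, ∇_X X⟩`. The last term vanishes at
  -- the critical point, so no Christoffel symbols enter.
  have hmetric := leviCivita_metric hX hgrad hX
  rw [hcrit, inner_zero_left, add_zero] at hmetric
  refine hmetric.symm.trans ?_
  have heq : (fun y => inner ℝ (riemannianGradient (E := E) f y) (X y))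
      =ᶠ[𝓝 x] (fun q => fderiv ℝ g q w) ∘ φ := by
    filter_upwards [extChartAt_source_mem_nhds (I := 𝓘(ℝ, E)) x] with y hy
    rw [inner_riemannianGradient]
    exact mvfderiv_trivializationAt_symmL hf hy w
  have hg : DifferentiableAt ℝ (fderiv ℝ g) (φ x) :=
    ((contDiffAt_comp_extChartAt_symm hf (mem_extChartAt_target x)).fderiv_right (m := 1)
      (by norm_cast)).differentiableAt one_ne_zero
  have hgw : DifferentiableAt ℝ (fun q => fderiv ℝ g q w) (φ x) := hg.clm_apply (by simp)
  have hφX : mfderiv 𝓘(ℝ, E) 𝓘(ℝ, E) φ x (X x) = w := by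
    rw [← TangentBundle.continuousLinearMapAt_trivializationAt (mem_chart_source E x)]
    exact e.continuousLinearMapAt_symmL (R := ℝ) hxe w
  have h1 : d% (fun y => inner ℝ (riemannianGradient (E := E) f y) (X y)) x
      = d% ((fun q => fderiv ℝ g q w) ∘ φ) x := by
    ext1 v
    exact DFunLike.congr_fun heq.mfderiv_eq v
  rw [h1, mvfderiv_comp_apply x hgw.mdifferentiableAt
    (mdifferentiableAt_extChartAt (mem_chart_source E x)), hφX]
  simp only [mvfderiv, mfderiv_eq_fderiv]
  change fderiv ℝ (fun q => fderiv ℝ g q w) (φ x) w = _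
  rw [fderiv_clm_apply hg (by simp)]
  simp

lemma eventually_lt_of_hessianPosDef {f : M → ℝ} (hf : CMDiff ∞ f) {x : M}
    (hcrit : riemannianGradient (E := E) f x = 0) (hpos : HessianPosDef E f x) :
    ∀ᶠ y in 𝓝 x, y ≠ x → f x < f y := by
  set φ := extChartAt 𝓘(ℝ, E) x
  let e := trivializationAt E (TangentSpace 𝓘(ℝ, E) : M → Type _) x
  have hxe : x ∈ e.baseSet := FiberBundle.mem_baseSet_trivializationAt' x
  have hp : φ x ∈ φ.target := mem_extChartAt_target x
  have hg : ContDiffAt ℝ ∞ (f ∘ φ.symm) (φ x) := contDiffAt_comp_extChartAt_symm hf hp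
  have key : ∀ᶠ q in 𝓝 (φ x), q ≠ φ x → (f ∘ φ.symm) (φ x) < (f ∘ φ.symm) q := by
    refine eventually_lt_of_fderiv_fderiv_pos ?_ (((hg.fderiv_right (m := 1)
      (by norm_cast)).differentiableAt one_ne_zero).hasFDerivAt) ?_ fun w hw => ?_
    · filter_upwards [(isOpen_extChartAt_target x).mem_nhds hp] with q hq
      exact (contDiffAt_comp_extChartAt_symm hf hq).differentiableAt (by simp)
    · ext w
      rw [← mvfderiv_trivializationAt_symmL hf (mem_extChartAt_source x),
        ← inner_riemannianGradient, hcrit, inner_zero_left]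
      rfl
    -- The trivialization is invertible at `x`, so a nonzero `w` represents a nonzero tangent
    -- vector.
    · rw [← inner_riemannianHessian_of_gradient_eq_zero hf hcrit]
      refine hpos _ fun h0 => hw ?_
      rw [← e.continuousLinearMapAt_symmL (R := ℝ) hxe w]
      exact (congrArg _ h0).trans (map_zero _)
  filter_upwards [(continuousAt_extChartAt x).eventually key,
    extChartAt_source_mem_nhds (I := 𝓘(ℝ, E)) x]
    with y hy hys hne
  have := hy fun h => hne (φ.injOn hys (mem_extChartAt_source x) h)
  have hx : φ.symm (φ x) = x := φ.left_inv (mem_extChartAt_source x)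
  have hy : φ.symm (φ y) = y := φ.left_inv hys
  change f (φ.symm (φ x)) < f (φ.symm (φ y)) at this
  rwa [hx, hy] at this

end CriticalPoint

/-! ### Retraction balls as neighbourhoods -/

section RetractionNhds

variable {E : Type*} [NormedAddCommGroup E] [NormedSpace ℝ E]
  {M : Type*} [TopologicalSpace M] [ChartedSpace E M] [IsManifold 𝓘(ℝ, E) ∞ M]

/-- Over a fixed base point the trivialization is a fixed linear map of the fibre. This turns
properties of `R` on the tangent bundle into properties on the vector space `E`. -/
lemma contMDiff_tangentBundle_mk (x : M) :
    ContMDiff 𝓘(ℝ, E) 𝓘(ℝ, E).tangent ∞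
      (fun ξ : E => (⟨x, ξ⟩ : TangentBundle 𝓘(ℝ, E) M)) := by
  intro ξ
  rw [contMDiffAt_totalSpace]
  refine ⟨contMDiffAt_const, ?_⟩
  let e := trivializationAt E (TangentSpace 𝓘(ℝ, E) : M → Type _) x
  have hx : x ∈ e.baseSet := FiberBundle.mem_baseSet_trivializationAt' x
  let A : E →L[ℝ] E := e.continuousLinearMapAt ℝ x
  refine A.contMDiff.contMDiffAt.congr_of_eventuallyEq (Filter.Eventually.of_forall fun η => ?_)
  exact (congrFun (e.coe_linearMapAt_of_mem (R := ℝ) hx) η).symm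

variable (R : Retraction E M)

lemma Retraction.toFun_zero (x : M) : R.toFun ⟨x, 0⟩ = x := by
  have := congrArg TotalSpace.proj (R.tangentMap_curve ⟨x, 0⟩ (R.zero_mem x))
  simpa [tangentMap] using this

lemma Retraction.isOpen_fiber_domain (x : M) :
    IsOpen {ξ : E | (⟨x, ξ⟩ : TangentBundle 𝓘(ℝ, E) M) ∈ R.domain} :=
  R.isOpen_domain.preimage (contMDiff_tangentBundle_mk x).continuous

lemma Retraction.contMDiffAt_fiber {x : M} {ξ : E}
    (hξ : (⟨x, ξ⟩ : TangentBundle 𝓘(ℝ, E) M) ∈ R.domain) :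
    ContMDiffAt 𝓘(ℝ, E) 𝓘(ℝ, E) ∞
      (fun η : E => R.toFun (⟨x, η⟩ : TangentBundle 𝓘(ℝ, E) M)) ξ :=
  ContMDiffAt.comp ξ (R.contMDiffOn.contMDiffAt (R.isOpen_domain.mem_nhds hξ))
    (contMDiff_tangentBundle_mk x).contMDiffAt

lemma Retraction.contDiffAt_extChartAt_comp (x : M) :
    ContDiffAt ℝ ∞ (fun η : E => extChartAt 𝓘(ℝ, E) x
      (R.toFun (⟨x, η⟩ : TangentBundle 𝓘(ℝ, E) M))) 0 := by
  rw [← contMDiffAt_iff_contDiffAt]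
  refine ContMDiffAt.comp (g := extChartAt 𝓘(ℝ, E) x) (0 : E) ?_
    (R.contMDiffAt_fiber (R.zero_mem x))
  have h : R.toFun (⟨x, (0 : E)⟩ : TangentBundle 𝓘(ℝ, E) M) = x := R.toFun_zero x
  rw [h]
  exact contMDiffAt_extChartAt

/-- The differential at the origin of a retraction, read in the preferred chart. -/
lemma Retraction.fderiv_extChartAt_comp (x : M) :
    fderiv ℝ (fun η : E => extChartAt 𝓘(ℝ, E) x
      (R.toFun (⟨x, η⟩ : TangentBundle 𝓘(ℝ, E) M))) 0 = ContinuousLinearMap.id ℝ E := by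
  set φ := extChartAt 𝓘(ℝ, E) x
  set k : E → E := fun η => φ (R.toFun (⟨x, η⟩ : TangentBundle 𝓘(ℝ, E) M))
  have hk : HasFDerivAt k (fderiv ℝ k 0) 0 :=
    ((R.contDiffAt_extChartAt_comp x).differentiableAt (by simp)).hasFDerivAt
  have hdom {v : E} (hv : (⟨x, v⟩ : TangentBundle 𝓘(ℝ, E) M) ∈ R.domain) :
      fderiv ℝ k 0 v = v := by
    let γ : ℝ → M := fun t => R.toFun (⟨x, t • v⟩ : TangentBundle 𝓘(ℝ, E) M)
    have hγ0 : γ 0 = x := by simp only [γ, zero_smul]; exact R.toFun_zero x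
    have hs : HasDerivAt (fun t : ℝ => t • v) v 0 := by
      simpa using (hasDerivAt_id (0 : ℝ)).smul_const v
    have hγ : MDifferentiableAt 𝓘(ℝ, ℝ) 𝓘(ℝ, E) γ 0 := by
      refine MDifferentiableAt.comp (0 : ℝ)
        (g := fun η : E => R.toFun (⟨x, η⟩ : TangentBundle 𝓘(ℝ, E) M)) ?_
        hs.differentiableAt.mdifferentiableAt
      rw [zero_smul]
      exact (R.contMDiffAt_fiber (R.zero_mem x)).mdifferentiableAt (by simp)
    have hφ : MDifferentiableAt 𝓘(ℝ, E) 𝓘(ℝ, E) φ (γ 0) := by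
      rw [hγ0]
      exact mdifferentiableAt_extChartAt (mem_chart_source E x)
    -- The curve condition is an equality in the tangent bundle. Applying the tangent map of the
    -- chart and taking the fibre component, which lies in `E`, avoids transport between the tangent
    -- spaces at `γ 0` and `x`.
    have hcurve : (mfderiv 𝓘(ℝ, E) 𝓘(ℝ, E) φ (γ 0) (mfderiv 𝓘(ℝ, ℝ) 𝓘(ℝ, E) γ 0 (1 : ℝ)) : E)
        = mfderiv 𝓘(ℝ, E) 𝓘(ℝ, E) φ x v :=
      congrArg (fun p => ((tangentMap 𝓘(ℝ, E) 𝓘(ℝ, E) φ p).2 : E)) (R.tangentMap_curve _ hv)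
    rw [mfderiv_extChartAt_self] at hcurve
    have hchain : (mfderiv 𝓘(ℝ, ℝ) 𝓘(ℝ, E) (φ ∘ γ) 0 (1 : ℝ) : E) = v := by
      rw [mfderiv_comp (0 : ℝ) hφ hγ]
      exact hcurve
    have hd : HasDerivAt (φ ∘ γ) (fderiv ℝ k 0 v) 0 := by
      refine HasFDerivAt.comp_hasDerivAt (0 : ℝ) (l := k) ?_ hs
      rwa [zero_smul]
    rw [mfderiv_eq_fderiv] at hchain
    exact hd.deriv.symm.trans hchain
  ext v
  -- The curve condition covers only vectors in the domain. A small nonzero multiple of `v` lies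
  -- there, and linearity of the derivative removes the factor `t`.
  have ht : Filter.Tendsto (fun t : ℝ => t • v) (𝓝[≠] 0) (𝓝 0) := by
    have : Continuous fun t : ℝ => t • v := by fun_prop
    simpa using (this.tendsto 0).mono_left nhdsWithin_le_nhds
  obtain ⟨t, htv, ht0⟩ := ((ht.eventually ((R.isOpen_fiber_domain x).mem_nhds
    (R.zero_mem x))).and self_mem_nhdsWithin).exists
  have := hdom htv
  rw [map_smul] at this
  exact smul_right_injective E ht0 this

/-- A retraction maps neighbourhoods of the origin onto neighbourhoods of the base point. -/
lemma Retraction.map_nhds_zero [CompleteSpace E] (x : M) :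
    Filter.map (fun η : E => R.toFun (⟨x, η⟩ : TangentBundle 𝓘(ℝ, E) M)) (𝓝 0) = 𝓝 x := by
  set φ := extChartAt 𝓘(ℝ, E) x
  have h0 : R.toFun (⟨x, (0 : E)⟩ : TangentBundle 𝓘(ℝ, E) M) = x := R.toFun_zero x
  have hd := (R.contDiffAt_extChartAt_comp x).hasStrictFDerivAt (by simp)
  -- A strictly differentiable map with surjective differential, here the identity, is locally open.
  have hmap := hd.map_nhds_eq_of_surj (by rw [R.fderiv_extChartAt_comp]; simp)
  have hcont : Filter.Tendsto (fun η : E => R.toFun (⟨x, η⟩ : TangentBundle 𝓘(ℝ, E) M))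
      (𝓝 0) (𝓝 x) := by
    have := (R.contMDiffAt_fiber (ξ := (0 : E)) (R.zero_mem x)).continuousAt.tendsto
    rwa [h0] at this
  have hev := hcont.eventually (extChartAt_source_mem_nhds (I := 𝓘(ℝ, E)) x)
  rw [h0] at hmap
  have hsymm : Filter.map φ.symm (𝓝 (φ x)) = 𝓝 x := by
    have := map_extChartAt_symm_nhdsWithin_range (I := 𝓘(ℝ, E)) x
    rwa [modelWithCornersSelf_coe, Set.range_id, nhdsWithin_univ] at this
  rw [← hsymm, ← hmap, Filter.map_map]
  exact Filter.map_congr (hev.mono fun η hη => (φ.left_inv hη).symm)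

variable [FiniteDimensional ℝ E] [RiemannianBundle (fun x : M => TangentSpace 𝓘(ℝ, E) x)]

/-- Small retraction balls are neighbourhoods of their centre, with closure in a given
neighbourhood. -/
lemma Retraction.exists_ball_mem_nhds [T2Space M] {x : M} {U : Set M} (hU : U ∈ 𝓝 x) :
    ∃ ρ : ℝ, 0 < ρ ∧
      (∀ ξ : TangentSpace 𝓘(ℝ, E) x, ‖ξ‖ ≤ ρ →
        (⟨x, ξ⟩ : TangentBundle 𝓘(ℝ, E) M) ∈ R.domain) ∧
      R.ball x ρ ∈ 𝓝 x ∧ closure (R.ball x ρ) ⊆ U := by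
  have := FiniteDimensional.complete ℝ E
  have := finiteDimensional_tangentSpace (E := E) x
  have : ProperSpace (TangentSpace 𝓘(ℝ, E) x) := FiniteDimensional.proper ℝ _
  -- Balls are now taken in the Riemannian norm, while `map_nhds_zero` is stated on `E`; the
  -- topologies agree, so the neighbourhoods of zero are the same.
  let h : TangentSpace 𝓘(ℝ, E) x → M := fun ξ => R.toFun ⟨x, ξ⟩
  have hmap : Filter.map h (𝓝 0) = 𝓝 x := R.map_nhds_zero x
  have hdom : {ξ : TangentSpace 𝓘(ℝ, E) x | (⟨x, ξ⟩ : TangentBundle 𝓘(ℝ, E) M) ∈ R.domain}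
      ∈ 𝓝 0 := (R.isOpen_fiber_domain x).mem_nhds (R.zero_mem x)
  have hpre : h ⁻¹' U ∈ 𝓝 0 := by rwa [← Filter.mem_map, hmap]
  obtain ⟨ρ, hρ, hsub⟩ := Metric.nhds_basis_closedBall.mem_iff.1 (Filter.inter_mem hdom hpre)
  have hcont : ContinuousOn h (Metric.closedBall 0 ρ) := fun ξ hξ =>
    (R.contMDiffAt_fiber (hsub hξ).1).continuousAt.continuousWithinAt
  refine ⟨ρ, hρ, fun ξ hξ => (hsub (mem_closedBall_zero_iff.2 hξ)).1, ?_, ?_⟩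
  · have himage : h '' Metric.ball 0 ρ ∈ 𝓝 x := by
      rw [← hmap]
      exact Filter.image_mem_map (Metric.ball_mem_nhds 0 hρ)
    refine Filter.mem_of_superset himage ?_
    rintro _ ⟨ξ, hξ, rfl⟩
    exact ⟨ξ, (hsub (Metric.ball_subset_closedBall hξ)).1, mem_ball_zero_iff.1 hξ, rfl⟩
  -- The image of the closed ball is compact, hence closed in the Hausdorff space `M`, and it
  -- contains the retraction ball.
  · refine (closure_minimal ?_
      ((isCompact_closedBall (0 : TangentSpace 𝓘(ℝ, E) x) ρ).image_of_continuousOn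
        hcont).isClosed).trans ?_
    · rintro _ ⟨ξ, -, hξ, rfl⟩
      exact ⟨ξ, mem_closedBall_zero_iff.2 hξ.le, rfl⟩
    · rintro _ ⟨ξ, hξ, rfl⟩
      exact (hsub hξ).2

end RetractionNhds

end RiemGeom

theorem mainTheorem7 {E : Type*} [NormedAddCommGroup E] [NormedSpace ℝ E] [FiniteDimensional ℝ E]
    {M : Type*} [TopologicalSpace M] [T2Space M] [ChartedSpace E M] [IsManifold 𝓘(ℝ, E) ∞ M]
    [RiemannianBundle (fun x : M => TangentSpace 𝓘(ℝ, E) x)]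
    [IsContMDiffRiemannianBundle 𝓘(ℝ, E) ∞ E (fun x : M => TangentSpace 𝓘(ℝ, E) x)]
    (R : RiemGeom.Retraction E M) (f : M → ℝ) (hf : ContMDiff 𝓘(ℝ, E) 𝓘(ℝ, ℝ) ∞ f)
    (xs : M) (hcrit : RiemGeom.riemannianGradient (E := E) f xs = 0)
    (hpos : RiemGeom.HessianPosDef E f xs) :
    ∃ ρ : ℝ, 0 < ρ ∧
      (∀ ξ : TangentSpace 𝓘(ℝ, E) xs, ‖ξ‖ ≤ ρ →
        (⟨xs, ξ⟩ : TangentBundle 𝓘(ℝ, E) M) ∈ R.domain) ∧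
      (∀ y ∈ closure (R.ball xs ρ), RiemGeom.HessianPosDef E f y) ∧
      ∃ c : ℝ, f xs < c ∧
        connectedComponentIn {y : M | f y ≤ c} xs ⊆ closure (R.ball xs ρ) := by
  have : LocallyCompactSpace M := Manifold.locallyCompact_of_finiteDimensional 𝓘(ℝ, E)
  obtain ⟨ρ, hρ, hdom, hball, hcl⟩ :=
    R.exists_ball_mem_nhds (RiemGeom.eventually_hessianPosDef hf hpos)
  obtain ⟨c, hc, hsub⟩ := RiemGeom.exists_connectedComponentIn_sublevel_subset hf.continuous
    (RiemGeom.eventually_lt_of_hessianPosDef hf hcrit hpos) hball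
  -- The component already lies in the open-radius ball `R.ball xs ρ`, before taking the closure.
  exact ⟨ρ, hρ, hdom, hcl, c, hc, hsub.trans subset_closure⟩
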